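/- Let $n\ge 1$ and $\hbar>0$. For $\psi,\phi\in L^2(\mathbb{R}^n)$ put $$W(\psi,\phi)(x,p)=\Big(\frac{1}{2\pi\hbar}\Big)^{n}\int_{\mathbb{R}^n}e^{-\frac{i}{\hbar}p\cdot y}\,\psi(x+\tfrac12 y)\,\overline{\phi(x-\tfrac12 y)}\,dy ,\qquad W\psi=W(\psi,\psi).$$ A density operator is a positive trace-class operator $\widehat\rho$ on $L^2(\mathbb{R}^n)$ with trace one. Its Wigner distribution is the function $\rho$ on $\mathbb{R}^{2n}$ for which $\widehat\rho$ is the Weyl operator $$\widehat\rho\,\psi(x)=\iint e^{\frac{i}{\hbar}p\cdot(x-y)}\,\rho\big(\tfrac12(x+y),p\big)\,\psi(y)\,dy\,dp ,$$ understood weakly: for all Schwartz functions $\psi,\phi$ on $\mathbb{R}^n$ the function $\rho\,W(\psi,\phi)$ is integrable and $$\int_{\mathbb{R}^n}(\widehat\rho\,\psi)(x)\,\overline{\phi(x)}\,dx=(2\pi\hbar)^n\int_{\mathbb{R}^{2n}}\rho(z)\,W(\psi,\phi)(z)\,dz .$$ A function on $\mathbb{R}^{2n}$ is said to have compact support if it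 vanishes almost everywhere outside some compact set. Then: 1. (Pure states) For every nonzero $\psi\in L^2(\mathbb{R}^n)$, the Wigner transform $W\psi$ does not have compact support. 2. (Mixed states) For every density operator $\widehat\rho$ on $L^2(\mathbb{R}^n)$, the Wigner distribution $\rho$ of $\widehat\rho$ does not have compact support. -/

import Mathlib

open MeasureTheory
open scoped SchwartzMap ComplexConjugate

noncomputable section

/-- Configuration space `ℝⁿ` with its Euclidean structure. -/
abbrev Config (n : ℕ) : Type := EuclideanSpace ℝ (Fin n)

/-- Phase space `ℝⁿ × ℝⁿ`, with points `z = (x, p)` and Lebesgue measure `dz = dx dp`. -/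
abbrev PhaseSpace (n : ℕ) : Type := Config n × Config n

/-- The Hilbert space `L²(ℝⁿ)` of complex-valued square-integrable functions. -/
abbrev L2Space (n : ℕ) : Type := Lp ℂ 2 (volume : Measure (Config n))

/-- The Wigner–Moyal transform
`W(ψ, φ)(x, p) = (1 / (2 π ℏ))ⁿ ∫ e^{-(i/ℏ) p·y} ψ(x + y/2) conj(φ(x - y/2)) dy`.
For `ψ, φ` in `L²(ℝⁿ)` the integrand is integrable for every `(x, p)`, and the value does not depend
on the representatives of `ψ` and `φ`. -/
def wignerMoyal {n : ℕ} (hbar : ℝ) (ψ φ : Config n → ℂ) (z : PhaseSpace n) : ℂ :=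
  ((1 / (2 * Real.pi * hbar) : ℝ) : ℂ) ^ n *
    ∫ y : Config n, Complex.exp (-(Complex.I / (hbar : ℂ)) * ((inner ℝ z.2 y : ℝ) : ℂ)) *
      ψ (z.1 + (1 / 2 : ℝ) • y) * conj (φ (z.1 - (1 / 2 : ℝ) • y))

/-- The Wigner transform `Wψ = W(ψ, ψ)` of `ψ`. -/
def wigner {n : ℕ} (hbar : ℝ) (ψ : Config n → ℂ) : PhaseSpace n → ℂ :=
  wignerMoyal hbar ψ ψ

/-- Density operators on `L²(ℝⁿ)`: positive (hence self-adjoint) trace-class operators with trace one.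
For a positive operator `T`, the sum `∑ ⟨b i, T (b i)⟩` over an orthonormal basis `b` has non-negative
terms and does not depend on `b`; `T` is trace class if and only if it is finite, and it is then the
trace of `T`. -/
structure IsDensityOperator {n : ℕ} (T : L2Space n →L[ℂ] L2Space n) : Prop where
  isPositive : T.IsPositive
  trace_eq_one : ∃ (ι : Type) (b : HilbertBasis ι ℂ (L2Space n)),
    HasSum (fun i => inner ℂ (b i) (T (b i))) 1

/-- `ρ` is the Wigner distribution of the operator `T`, i.e. `T` is the Weyl operator
`(T ψ)(x) = ∬ e^{(i/ℏ) p·(x - y)} ρ((x + y)/2, p) ψ(y) dy dp`.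
As usual in the Weyl calculus, where this integral need not converge absolutely, the formula is
understood weakly: pairing it with `φ` and substituting `(x + y/2, x - y/2)` for `(y, x)` turns it
into `⟨φ, T ψ⟩ = (2 π ℏ)ⁿ ∫ ρ(z) W(ψ, φ)(z) dz`, required for all Schwartz functions `ψ`, `φ`. -/
def IsWignerDistribution {n : ℕ} (hbar : ℝ) (T : L2Space n →L[ℂ] L2Space n)
    (ρ : PhaseSpace n → ℂ) : Prop :=
  ∀ ψ φ : 𝓢(Config n, ℂ),
    Integrable (fun z : PhaseSpace n => ρ z * wignerMoyal hbar ψ φ z) ∧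
      inner ℂ (φ.toLp 2) (T (ψ.toLp 2)) =
        ((2 * Real.pi * hbar : ℝ) : ℂ) ^ n * ∫ z : PhaseSpace n, ρ z * wignerMoyal hbar ψ φ z

/-- `f` has compact support in the almost-everywhere sense: it vanishes almost everywhere outside
some compact set. -/
def HasCompactSupportAE {n : ℕ} (f : PhaseSpace n → ℂ) : Prop :=
  ∃ K : Set (PhaseSpace n), IsCompact K ∧ ∀ᵐ z : PhaseSpace n, z ∉ K → f z = 0

end

/-!
Both halves rest on one form of the uncertainty principle, `ae_eq_zero_of_fourier_eqOn_zero`: an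
integrable function that vanishes outside a ball and whose Fourier transform vanishes on a nonempty
open set is zero, because the transform extends to an entire function along every line.

For fixed `x`, the function `W(ψ, ψ)(x, ·)` is, after rescaling, the Fourier transform of the
correlation `y ↦ ψ(x + y/2) conj(ψ(x - y/2))` (`wignerMoyal_eq_fourier`). The geometric input is that
the midpoint of two points of a half-space lies in that half-space.

*Pure states.* Suppose that `Wψ` vanishes for `‖x‖ > R` and for `‖p‖ > R`. For `‖x‖ > R` the correlation
is zero by injectivity of the Fourier transform, so `ψ(a) conj(ψ(b)) = 0` for almost all `a, b` in a
half-space outside the ball of radius `R`, and `ψ` vanishes outside this ball. Hence every correlation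
has bounded support; since its Fourier transform vanishes for large momenta, it is zero, and `ψ = 0`.

*Mixed states.* The spectral decomposition of `T` is not needed. If `ψ` is a test function supported in
a half-space of positions away from the support of `ρ`, then `W(ψ, ψ)` vanishes on the support of `ρ`
(`wignerCorrelation_eq_zero_of_halfSpace`), so that `⟨ψ, T ψ⟩ = 0` and, by positivity, `T ψ = 0`. As `T`
is self-adjoint, its range is orthogonal to all such `ψ`: every `T g` vanishes outside a ball. The same
argument for functions with Fourier transform supported in a half-space
(`fourier_wignerCorrelation_eq_zero_of_halfSpace`) shows that the Fourier transform of `T g` vanishes on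
a half-space. Hence `T g = 0` for all `g`, and the trace of `T` cannot be one.
-/

open scoped FourierTransform RealInnerProductSpace

/-! ### Fourier transforms of integrable functions -/

theorem exists_schwartzMap_eq_ofReal {V : Type*} [NormedAddCommGroup V] [NormedSpace ℝ V] {g : V → ℝ}
    (hg : ContDiff ℝ (⊤ : ℕ∞) g) (hgc : HasCompactSupport g) :
    ∃ G : 𝓢(V, ℂ), ∀ x, G x = (g x : ℂ) := by
  have hgC : ContDiff ℝ (⊤ : ℕ∞) fun x => (g x : ℂ) := Complex.ofRealCLM.contDiff.comp hg
  have hgcC : HasCompactSupport fun x => (g x : ℂ) := hgc.comp_left Complex.ofReal_zero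
  exact ⟨hgcC.toSchwartzMap hgC, fun x => rfl⟩

section PaleyWiener

variable {V : Type*} [NormedAddCommGroup V] [InnerProductSpace ℝ V] [FiniteDimensional ℝ V]
  [MeasurableSpace V] [BorelSpace V]

theorem continuous_fourier_of_integrable {f : V → ℂ} (hf : Integrable f) : Continuous (𝓕 f) :=
  VectorFourier.fourierIntegral_continuous Real.continuous_fourierChar continuous_inner hf

theorem integral_fourier_mul_eq_of_integrable {f g : V → ℂ} (hf : Integrable f)
    (hg : Integrable g) : ∫ ξ, 𝓕 f ξ * g ξ = ∫ x, f x * 𝓕 g x := by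
  simpa using! VectorFourier.integral_bilin_fourierIntegral_eq_flip (.mul ℂ ℂ) (L := innerₗ V)
    Real.continuous_fourierChar continuous_inner hf hg

/-- The Fourier transform is injective on `L¹`. Since it is its own transpose and maps the Schwartz
space onto itself, a function with vanishing transform is orthogonal to every test function. -/
theorem ae_eq_zero_of_fourier_ae_eq_zero {f : V → ℂ} (hf : Integrable f)
    (h : 𝓕 f =ᵐ[volume] 0) : f =ᵐ[volume] 0 := by
  refine ae_eq_zero_of_integral_contDiff_smul_eq_zero hf.locallyIntegrable fun g hg hgc => ?_
  obtain ⟨G, hGg⟩ := exists_schwartzMap_eq_ofReal hg hgc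
  have hG : 𝓕 (𝓕⁻ G : 𝓢(V, ℂ)) = G := FourierTransform.fourier_fourierInv_eq G
  calc ∫ x, g x • f x = ∫ x, 𝓕 ((𝓕⁻ G : 𝓢(V, ℂ)) : V → ℂ) x * f x := by
        rw [← SchwartzMap.fourier_coe, hG]; simp [hGg]
    _ = ∫ x, (𝓕⁻ G : 𝓢(V, ℂ)) x * 𝓕 f x :=
        integral_fourier_mul_eq_of_integrable (𝓕⁻ G : 𝓢(V, ℂ)).integrable hf
    _ = 0 := by
        refine integral_eq_zero_of_ae ?_
        filter_upwards [h] with x hx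
        simp [hx]

/-- Where `f` does not vanish, `b` is bounded, so the integrand and its derivative in `t` are
dominated by a multiple of `‖f‖` for `t` in a bounded set. -/
theorem differentiable_integral_cexp_mul {a : V → ℂ} {b : V → ℝ} {f : V → ℂ} {C : ℝ}
    (ha : Continuous a) (hb : Continuous b)
    (haC : ∀ y, ‖Complex.exp (a y)‖ ≤ 1) (hf : Integrable f)
    (hC : ∀ᵐ y, f y ≠ 0 → |b y| ≤ C) :
    Differentiable ℂ fun t : ℂ => ∫ y, Complex.exp (a y + t * (b y * Complex.I)) * f y := by
  intro t₀
  have hexp : ∀ t ∈ Metric.ball t₀ 1, ∀ y, |b y| ≤ C →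
      ‖Complex.exp (a y + t * (b y * Complex.I))‖ ≤ Real.exp ((‖t₀‖ + 1) * C) := by
    intro t ht y hy
    rw [Complex.exp_add, norm_mul]
    refine (mul_le_of_le_one_left (norm_nonneg _) (haC y)).trans ?_
    rw [Complex.norm_exp]
    refine Real.exp_le_exp.2 ?_
    refine (Complex.re_le_norm _).trans ?_
    have ht' : ‖t‖ ≤ ‖t₀‖ + 1 := by
      have := norm_le_norm_add_norm_sub' t t₀
      rw [Metric.mem_ball, dist_eq_norm] at ht
      linarith
    simp only [norm_mul, Complex.norm_I, mul_one, Complex.norm_real, Real.norm_eq_abs]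
    gcongr
  have hmeas : ∀ t : ℂ, AEStronglyMeasurable
      (fun y => Complex.exp (a y + t * (b y * Complex.I)) * f y) volume := fun t =>
    (Continuous.aestronglyMeasurable (by fun_prop)).mul hf.1
  refine (hasDerivAt_integral_of_dominated_loc_of_deriv_le (𝕜 := ℂ) (μ := volume)
    (F := fun t y => Complex.exp (a y + t * (b y * Complex.I)) * f y)
    (F' := fun t y => Complex.exp (a y + t * (b y * Complex.I)) * (b y * Complex.I) * f y)
    (bound := fun y => Real.exp ((‖t₀‖ + 1) * C) * C * ‖f y‖)
    (Metric.ball_mem_nhds t₀ one_pos) (.of_forall hmeas) ?_ ?_ ?_ ?_ ?_).2.differentiableAt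
  · refine Integrable.mono' (hf.norm.const_mul (Real.exp ((‖t₀‖ + 1) * C))) (hmeas t₀) ?_
    filter_upwards [hC] with y hy
    rcases eq_or_ne (f y) 0 with h0 | h0
    · simp [h0]
    · rw [norm_mul]
      gcongr
      exact hexp t₀ (Metric.mem_ball_self one_pos) y (hy h0)
  · exact (Continuous.aestronglyMeasurable (by fun_prop)).mul hf.1
  · filter_upwards [hC] with y hy t ht
    rcases eq_or_ne (f y) 0 with h0 | h0
    · simp [h0]
    · rw [norm_mul, norm_mul]
      gcongr
      · exact hexp t ht y (hy h0)
      · simpa using hy h0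
  · exact hf.norm.const_mul _
  · refine .of_forall fun y t _ => ?_
    have h : HasDerivAt (fun t : ℂ => a y + t * (b y * Complex.I)) (b y * Complex.I) t := by
      simpa using ((hasDerivAt_id t).mul_const ((b y : ℂ) * Complex.I)).const_add (a y)
    exact h.cexp.mul_const (f y)

/-- An integrable function that vanishes outside a ball is zero as soon as its Fourier transform
vanishes on a nonempty open set: along every real line the transform extends to an entire
function of one variable, to which the identity theorem applies. -/
theorem ae_eq_zero_of_fourier_eqOn_zero {f : V → ℂ} (hf : Integrable f) {R : ℝ}
    (hR : ∀ᵐ y, R < ‖y‖ → f y = 0) {U : Set V} (hU : IsOpen U) (hne : U.Nonempty)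
    (h : Set.EqOn (𝓕 f) 0 U) : f =ᵐ[volume] 0 := by
  refine ae_eq_zero_of_fourier_ae_eq_zero hf (.of_forall fun q => ?_)
  obtain ⟨p, hp⟩ := hne
  let g : ℂ → ℂ := fun t => ∫ y, Complex.exp (((-2 * Real.pi * ⟪y, p⟫ : ℝ) : ℂ) * Complex.I +
    t * (((-2 * Real.pi * ⟪y, q - p⟫ : ℝ) : ℂ) * Complex.I)) * f y
  have hg : Differentiable ℂ g := by
    refine differentiable_integral_cexp_mul (C := 2 * Real.pi * (R * ‖q - p‖))
      (by fun_prop) (by fun_prop) (fun y => (Complex.norm_exp_ofReal_mul_I _).le) hf ?_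
    filter_upwards [hR] with y hy h0
    have hyR : ‖y‖ ≤ R := not_lt.1 fun h' => h0 (hy h')
    rw [abs_mul, abs_mul, abs_neg, abs_two, abs_of_pos Real.pi_pos]
    gcongr
    exact (abs_real_inner_le_norm _ _).trans (by gcongr)
  have hline : ∀ s : ℝ, g s = 𝓕 f (p + s • (q - p)) := by
    intro s
    rw [Real.fourier_eq']
    refine integral_congr_ae (.of_forall fun y => ?_)
    simp only [smul_eq_mul]
    congr 2
    rw [inner_add_right, inner_smul_right]
    push_cast
    ring
  -- `p + s • (q - p)` stays in `U` for small real `s`, so the zeros of `g` accumulate at `0`.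
  have hfreq : ∃ᶠ t in nhdsWithin (0 : ℂ) {0}ᶜ, g t = 0 := by
    have hmap : Filter.Tendsto (fun s : ℝ => (s : ℂ)) (nhdsWithin 0 {0}ᶜ)
        (nhdsWithin 0 {0}ᶜ) := by
      refine tendsto_nhdsWithin_iff.2 ⟨?_, ?_⟩
      · exact (Complex.continuous_ofReal.tendsto' 0 0 rfl).mono_left nhdsWithin_le_nhds
      · filter_upwards [self_mem_nhdsWithin] with s hs
        simpa using hs
    refine hmap.frequently (Filter.Eventually.frequently ?_)
    have hc : Filter.Tendsto (fun s : ℝ => p + s • (q - p)) (nhds 0) (nhds p) :=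
      Continuous.tendsto' (by fun_prop) _ _ (by simp)
    filter_upwards [nhdsWithin_le_nhds (hc (hU.mem_nhds hp))] with s hs
    rw [hline]
    exact h hs
  have hzero : Set.EqOn g 0 Set.univ :=
    (hg.differentiableOn.analyticOnNhd isOpen_univ).eqOn_zero_of_preconnected_of_frequently_eq_zero
      isPreconnected_univ (Set.mem_univ 0) hfreq
  have := hline 1
  rw [one_smul, add_sub_cancel] at this
  rw [← this]
  exact hzero (Set.mem_univ _)

end PaleyWiener

/-! ### Half-spaces and positive operators -/

/-- The complement of the closed ball of radius `R` is the union of the half-spaces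
`R * ‖u‖ < ⟪u, x⟫`. -/
theorem ae_eq_zero_of_forall_halfSpace {V : Type*} [NormedAddCommGroup V] [InnerProductSpace ℝ V]
    [SecondCountableTopology V] [MeasurableSpace V] {μ : Measure V} {E : Type*} [Zero E]
    {f : V → E} {R : ℝ} (hR : 0 ≤ R) (h : ∀ u : V, ∀ᵐ x ∂μ, R * ‖u‖ < ⟪u, x⟫ → f x = 0) :
    ∀ᵐ x ∂μ, R < ‖x‖ → f x = 0 := by
  rw [ae_iff]
  refine measure_null_of_locally_null _ fun x hx => ?_
  have hRx : R < ‖x‖ := (Classical.not_imp.1 hx).1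
  have hopen : IsOpen {y : V | R * ‖x‖ < ⟪x, y⟫} := isOpen_lt (by fun_prop) (by fun_prop)
  have hmem : R * ‖x‖ < ⟪x, x⟫ := by
    rw [real_inner_self_eq_norm_mul_norm]
    exact mul_lt_mul_of_pos_right hRx (hR.trans_lt hRx)
  refine ⟨_, ?_, ae_iff.1 (h x)⟩
  filter_upwards [self_mem_nhdsWithin, nhdsWithin_le_nhds (hopen.mem_nhds hmem)] with y hy hy'
  exact fun hf => hy fun _ => hf hy'

theorem ContinuousLinearMap.IsPositive.apply_eq_zero_of_inner_eq_zero {H : Type*}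
    [NormedAddCommGroup H] [InnerProductSpace ℂ H] [CompleteSpace H] {T : H →L[ℂ] H}
    (hT : T.IsPositive) {v : H} (hv : inner ℂ v (T v) = 0) : T v = 0 := by
  have hT0 : 0 ≤ T := (ContinuousLinearMap.nonneg_iff_isPositive T).2 hT
  have hS : (CFC.sqrt T).IsPositive :=
    (ContinuousLinearMap.nonneg_iff_isPositive _).1 (CFC.sqrt_nonneg T)
  have hmul : ∀ w, CFC.sqrt T (CFC.sqrt T w) = T w := fun w =>
    congrArg (fun A : H →L[ℂ] H => A w) (CFC.sqrt_mul_sqrt_self T hT0)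
  have h0 : CFC.sqrt T v = 0 := by
    rw [← inner_self_eq_zero (𝕜 := ℂ), hS.inner_left_eq_inner_right, hmul, hv]
  rw [← hmul, h0, map_zero]

/-! ### The Wigner transform as a Fourier transform -/

section Wigner

variable {n : ℕ}

/-- The function `y ↦ ψ(x + y/2) conj(φ(x - y/2))`, whose Fourier transform is `W(ψ, φ)(x, ·)` up to
the scaling `w = p / (2 π ℏ)` and a nonzero constant. -/
noncomputable def wignerCorrelation (ψ φ : Config n → ℂ) (x y : Config n) : ℂ :=
  ψ (x + (1 / 2 : ℝ) • y) * conj (φ (x - (1 / 2 : ℝ) • y))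

theorem wignerMoyal_eq_fourier {hbar : ℝ} (ψ φ : Config n → ℂ) (z : PhaseSpace n) :
    wignerMoyal hbar ψ φ z = ((1 / (2 * Real.pi * hbar) : ℝ) : ℂ) ^ n *
      𝓕 (wignerCorrelation ψ φ z.1) ((2 * Real.pi * hbar)⁻¹ • z.2) := by
  rw [wignerMoyal, Real.fourier_eq']
  congr 1
  refine integral_congr_ae (.of_forall fun y => ?_)
  simp only [smul_eq_mul, wignerCorrelation]
  rw [← mul_assoc]
  congr 3
  rw [inner_smul_right, real_inner_comm]
  push_cast
  have : (Real.pi : ℂ) ≠ 0 := by exact_mod_cast Real.pi_ne_zero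
  by_cases hh : (hbar : ℂ) = 0
  · simp [hh]
  · field_simp

theorem wignerMoyal_eq_zero_iff {hbar : ℝ} (hh : hbar ≠ 0) (ψ φ : Config n → ℂ)
    (z : PhaseSpace n) : wignerMoyal hbar ψ φ z = 0 ↔
      𝓕 (wignerCorrelation ψ φ z.1) ((2 * Real.pi * hbar)⁻¹ • z.2) = 0 := by
  rw [wignerMoyal_eq_fourier, mul_eq_zero, or_iff_right]
  refine pow_ne_zero _ ?_
  exact_mod_cast one_div_ne_zero (by positivity)

theorem quasiMeasurePreserving_add_smul (x : Config n) {c : ℝ} (hc : c ≠ 0) :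
    Measure.QuasiMeasurePreserving (fun y : Config n => x + c • y) volume volume :=
  (quasiMeasurePreserving_add_left volume x).comp (Measure.quasiMeasurePreserving_smul volume hc)

theorem MeasureTheory.MemLp.comp_add_smul {f : Config n → ℂ} (hf : MemLp f 2) (x : Config n)
    {c : ℝ} (hc : c ≠ 0) : MemLp (fun y => f (x + c • y)) 2 := by
  refine (memLp_two_iff_integrable_sq_norm (hf.1.comp_quasiMeasurePreserving
    (quasiMeasurePreserving_add_smul x hc))).2 ?_
  have h1 := (memLp_two_iff_integrable_sq_norm hf.1).1 hf
  exact (h1.comp_add_left x).comp_smul hc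

theorem integrable_wignerCorrelation {ψ φ : Config n → ℂ} (hψ : MemLp ψ 2) (hφ : MemLp φ 2)
    (x : Config n) : Integrable (wignerCorrelation ψ φ x) := by
  have h1 := hψ.comp_add_smul x (c := 1 / 2) (by norm_num)
  have h2 := hφ.comp_add_smul x (c := -(1 / 2)) (by norm_num)
  refine (h1.integrable_mul h2.star).congr (.of_forall fun y => ?_)
  simp [wignerCorrelation, sub_eq_add_neg]

/-- If `ψ` lives on the half-space `c < ⟪u, ·⟫`, then `W(ψ, ψ)` vanishes at the positions `x` outside it:
of the two points `x ± y/2`, with midpoint `x`, at least one lies outside as well. -/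
theorem wignerCorrelation_eq_zero_of_halfSpace {ψ : Config n → ℂ} {u : Config n} {c : ℝ}
    (h : ∀ y, ⟪u, y⟫ ≤ c → ψ y = 0) {x : Config n} (hx : ⟪u, x⟫ ≤ c) :
    wignerCorrelation ψ ψ x = 0 := by
  ext y
  simp only [wignerCorrelation, Pi.zero_apply, mul_eq_zero, map_eq_zero]
  rcases le_total 0 ⟪u, y⟫ with hy | hy
  · refine .inr (h _ ?_)
    rw [inner_sub_right, inner_smul_right]
    linarith
  · refine .inl (h _ ?_)
    rw [inner_add_right, inner_smul_right]
    linarith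

theorem integral_comp_add_half_smul (x : Config n) (F : Config n → ℂ) :
    ∫ y, F (x + (1 / 2 : ℝ) • y) = 2 ^ n * ∫ v, F v := by
  rw [Measure.integral_comp_smul volume (fun v => F (x + v)), integral_add_left_eq_self]
  simp

theorem fourier_comp_add_half_smul (ψ : Config n → ℂ) (x w : Config n) :
    𝓕 (fun y => ψ (x + (1 / 2 : ℝ) • y)) w =
      2 ^ n * (Real.fourierChar (2 * ⟪x, w⟫) * 𝓕 ψ ((2 : ℝ) • w)) := by
  have := integral_comp_add_half_smul x
    (fun v => (Real.fourierChar (-⟪(2 : ℝ) • (v - x), w⟫) : ℂ) * ψ v)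
  rw [Real.fourier_eq, Real.fourier_eq]
  simp only [Circle.smul_def, smul_eq_mul]
  rw [← integral_const_mul]
  refine Eq.trans (integral_congr_ae (.of_forall fun y => ?_)) (this.trans ?_)
  · simp [smul_smul]
  · refine congrArg _ (integral_congr_ae (.of_forall fun v => ?_))
    dsimp only
    rw [← mul_assoc, ← Circle.coe_mul, ← AddChar.map_add_eq_mul]
    congr 3
    simp only [inner_smul_left, inner_smul_right, inner_sub_left, conj_trivial]
    ring

/-- If the Fourier transform `χ` of `ψ` lives on the half-space `c < ⟪u, ·⟫`, then `W(ψ, ψ)` vanishes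
at the momenta outside it. Writing `conj (ψ (x - y/2))` as a Fourier integral over `ξ` turns the
transform at `w` into an integral of `conj (χ ξ) * χ (2 w - ξ)` times phases, and `w` is the midpoint
of `ξ` and `2 w - ξ`. -/
theorem fourier_wignerCorrelation_eq_zero_of_halfSpace (χ : 𝓢(Config n, ℂ)) {u : Config n} {c : ℝ}
    (h : ∀ ξ, ⟪u, ξ⟫ ≤ c → χ ξ = 0) (x : Config n) {w : Config n} (hw : ⟪u, w⟫ ≤ c) :
    𝓕 (wignerCorrelation (𝓕⁻ χ : 𝓢(Config n, ℂ)) (𝓕⁻ χ : 𝓢(Config n, ℂ)) x) w = 0 := by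
  set ψ : 𝓢(Config n, ℂ) := 𝓕⁻ χ with hψ
  have hFψ : 𝓕 (ψ : Config n → ℂ) = χ := by
    rw [← SchwartzMap.fourier_coe, hψ, FourierTransform.fourier_fourierInv_eq]
  let f : Config n → ℂ := fun ξ => Real.fourierChar (-⟪ξ, x⟫) * conj (χ ξ)
  let g : Config n → ℂ := fun y => Real.fourierChar (-⟪y, w⟫) * ψ (x + (1 / 2 : ℝ) • y)
  have hf : Integrable f :=
    (Real.fourierIntegral_convergent_iff (f := fun ξ => conj (χ ξ)) x).2
      (Complex.conjCLE.toContinuousLinearMap.integrable_comp χ.integrable)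
  have hg : Integrable g :=
    (Real.fourierIntegral_convergent_iff (f := fun y => ψ (x + (1 / 2 : ℝ) • y)) w).2
      ((ψ.integrable.comp_add_left x).comp_smul (by norm_num))
  -- The phase `𝐞(⟪ξ, y⟫ / 2)` of `conj (ψ (x - y/2))` is `𝐞(-L ξ y)`.
  let L : Config n →ₗ[ℝ] Config n →ₗ[ℝ] ℝ := (-(1 / 2 : ℝ)) • innerₗ (Config n)
  have key := VectorFourier.integral_bilin_fourierIntegral_eq_flip (.mul ℂ ℂ) (L := L)
    (μ := volume) (ν := volume) Real.continuous_fourierChar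
    (by simp only [L, LinearMap.smul_apply, innerₗ_apply_apply]; fun_prop) hf hg
  have hleft : ∀ y, VectorFourier.fourierIntegral Real.fourierChar volume L f y =
      conj (ψ (x - (1 / 2 : ℝ) • y)) := by
    intro y
    rw [hψ, SchwartzMap.fourierInv_coe, Real.fourierInv_eq, ← integral_conj]
    refine integral_congr_ae (.of_forall fun ξ => ?_)
    simp only [f, L, Circle.smul_def, smul_eq_mul, LinearMap.smul_apply, innerₗ_apply_apply,
      map_mul, ← Circle.coe_inv_eq_conj, ← AddChar.map_neg_eq_inv]
    rw [← mul_assoc, ← Circle.coe_mul, ← AddChar.map_add_eq_mul]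
    congr 3
    rw [inner_sub_right, inner_smul_right]
    ring
  have hright : ∀ ξ, VectorFourier.fourierIntegral Real.fourierChar volume L.flip g ξ =
      𝓕 (fun y => ψ (x + (1 / 2 : ℝ) • y)) (w - (1 / 2 : ℝ) • ξ) := by
    intro ξ
    rw [Real.fourier_eq]
    refine integral_congr_ae (.of_forall fun y => ?_)
    simp only [g, L, Circle.smul_def, smul_eq_mul, LinearMap.flip_apply, LinearMap.smul_apply,
      innerₗ_apply_apply]
    rw [← mul_assoc, ← Circle.coe_mul, ← AddChar.map_add_eq_mul]
    congr 3
    rw [inner_sub_right, inner_smul_right, real_inner_comm]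
    ring
  have hlhs : 𝓕 (wignerCorrelation ψ ψ x) w =
      ∫ y, ContinuousLinearMap.mul ℂ ℂ
        (VectorFourier.fourierIntegral Real.fourierChar volume L f y) (g y) := by
    rw [Real.fourier_eq]
    refine integral_congr_ae (.of_forall fun y => ?_)
    simp only [hleft, g, wignerCorrelation, Circle.smul_def, smul_eq_mul,
      ContinuousLinearMap.mul_apply']
    ring
  rw [hlhs, key]
  refine integral_eq_zero_of_ae (.of_forall fun ξ => ?_)
  simp only [hright, fourier_comp_add_half_smul, hFψ, ContinuousLinearMap.mul_apply',
    Pi.zero_apply, f]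
  rcases le_total ⟪u, ξ⟫ c with hξ | hξ
  · simp [h ξ hξ]
  · rw [h ((2 : ℝ) • (w - (1 / 2 : ℝ) • ξ))]
    · simp
    · rw [inner_smul_right, inner_sub_right, inner_smul_right]
      linarith

end Wigner

/-! ### Pure states -/

section PureState

variable {n : ℕ}

theorem HasCompactSupportAE.exists_radius {f : PhaseSpace n → ℂ} (hf : HasCompactSupportAE f) :
    ∃ R : ℝ, 0 ≤ R ∧ ∀ᵐ z, R < ‖z‖ → f z = 0 := by
  obtain ⟨K, hK, h⟩ := hf
  obtain ⟨R, hR⟩ := hK.isBounded.subset_closedBall (0 : PhaseSpace n)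
  refine ⟨max R 0, le_max_right _ _, ?_⟩
  filter_upwards [h] with z hz hRz
  refine hz fun hzK => ?_
  have := hR hzK
  rw [mem_closedBall_zero_iff] at this
  exact absurd (this.trans (le_max_left R 0)) hRz.not_ge

theorem quasiMeasurePreserving_midpoint_sub :
    Measure.QuasiMeasurePreserving
      (fun q : PhaseSpace n => ((1 / 2 : ℝ) • (q.1 + q.2), q.1 - q.2)) volume volume := by
  let A : PhaseSpace n →ₗ[ℝ] PhaseSpace n :=
    LinearMap.prod ((1 / 2 : ℝ) • (LinearMap.fst ℝ _ _ + LinearMap.snd ℝ _ _))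
      (LinearMap.fst ℝ _ _ - LinearMap.snd ℝ _ _)
  let B : PhaseSpace n →ₗ[ℝ] PhaseSpace n :=
    LinearMap.prod (LinearMap.fst ℝ _ _ + (1 / 2 : ℝ) • LinearMap.snd ℝ _ _)
      (LinearMap.fst ℝ _ _ - (1 / 2 : ℝ) • LinearMap.snd ℝ _ _)
  -- `B (x, y) = (x + y/2, x - y/2)` inverts `A (a, b) = ((a + b)/2, a - b)`.
  have hBA : B ∘ₗ A = LinearMap.id := by
    refine LinearMap.ext fun q => Prod.ext ?_ ?_ <;> simp [A, B] <;> module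
  have hdet : LinearMap.det A ≠ 0 := by
    intro h
    have := congrArg LinearMap.det hBA
    rw [LinearMap.det_comp, h, mul_zero, LinearMap.det_id] at this
    exact zero_ne_one this
  have : (volume : Measure (PhaseSpace n)).IsAddHaarMeasure := by
    rw [Measure.volume_eq_prod]; infer_instance
  exact Measure.LinearMap.quasiMeasurePreserving volume A hdet

/-- If almost every correlation `ψ(x + y/2) conj(ψ(x - y/2))` with midpoint `x` in the convex set `S`
vanishes, then `ψ a * conj (ψ b) = 0` for almost all `a, b ∈ S`, whence `ψ` vanishes on `S`. -/
theorem ae_eq_zero_of_wignerCorrelation_ae_eq_zero {ψ : Config n → ℂ} (hψ : StronglyMeasurable ψ)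
    {S : Set (Config n)} (hS : MeasurableSet S) (hconv : Convex ℝ S)
    (h : ∀ᵐ x, x ∈ S → wignerCorrelation ψ ψ x =ᵐ[volume] 0) : ∀ᵐ x, x ∈ S → ψ x = 0 := by
  have hm : Measurable fun z : PhaseSpace n => wignerCorrelation ψ ψ z.1 z.2 := by
    have hψm := hψ.measurable
    unfold wignerCorrelation
    have h1 : Measurable fun z : PhaseSpace n => z.1 + (1 / 2 : ℝ) • z.2 :=
      Continuous.measurable (by fun_prop)
    have h2 : Measurable fun z : PhaseSpace n => z.1 - (1 / 2 : ℝ) • z.2 :=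
      Continuous.measurable (by fun_prop)
    exact (hψm.comp h1).mul (Complex.continuous_conj.measurable.comp (hψm.comp h2))
  have hprod : ∀ᵐ z : PhaseSpace n, z.1 ∈ S → wignerCorrelation ψ ψ z.1 z.2 = 0 := by
    rw [Measure.volume_eq_prod, Measure.ae_prod_iff_ae_ae]
    · filter_upwards [h] with x hx
      by_cases hxS : x ∈ S
      · filter_upwards [hx hxS] with y hy _ using hy
      · exact .of_forall fun y hy => absurd hy hxS
    · have : {z : PhaseSpace n | z.1 ∈ S → wignerCorrelation ψ ψ z.1 z.2 = 0} =
          (Prod.fst ⁻¹' S)ᶜ ∪ {z | wignerCorrelation ψ ψ z.1 z.2 = 0} := by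
        ext z
        simp [imp_iff_not_or]
      rw [this]
      exact (measurable_fst hS).compl.union (measurableSet_eq_fun hm measurable_const)
  have hab := quasiMeasurePreserving_midpoint_sub.ae hprod
  rw [Measure.volume_eq_prod] at hab
  by_contra hcon
  have hfreq : ∃ᶠ a in ae volume, ¬ (a ∈ S → ψ a = 0) := Filter.not_eventually.1 hcon
  obtain ⟨a, ha, hb⟩ := (hfreq.and_eventually (Measure.ae_ae_of_ae_prod hab)).exists
  obtain ⟨haS, ha0⟩ := Classical.not_imp.1 ha
  refine hcon ?_
  filter_upwards [hb] with b hb hbS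
  have hmid : (1 / 2 : ℝ) • (a + b) ∈ S := by
    rw [smul_add]
    exact hconv haS hbS (by norm_num) (by norm_num) (by norm_num)
  have h0 := hb hmid
  have e1 : (1 / 2 : ℝ) • (a + b) + (1 / 2 : ℝ) • (a - b) = a := by module
  have e2 : (1 / 2 : ℝ) • (a + b) - (1 / 2 : ℝ) • (a - b) = b := by module
  simp only [wignerCorrelation, e1, e2] at h0
  simpa [ha0] using h0

theorem ae_lt_norm_wignerCorrelation_eq_zero {ψ : Config n → ℂ} {R : ℝ}
    (h : ∀ᵐ x, R < ‖x‖ → ψ x = 0) (x : Config n) :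
    ∀ᵐ y, 2 * R < ‖y‖ → wignerCorrelation ψ ψ x y = 0 := by
  filter_upwards [(quasiMeasurePreserving_add_smul x (c := 1 / 2) (by norm_num)).ae h,
    (quasiMeasurePreserving_add_smul x (c := -(1 / 2)) (by norm_num)).ae h] with y h1 h2 hy
  rw [neg_smul, ← sub_eq_add_neg] at h2
  by_contra hne
  simp only [wignerCorrelation, mul_eq_zero, map_eq_zero, not_or] at hne
  have h3 := not_lt.1 fun h' => hne.1 (h1 h')
  have h4 := not_lt.1 fun h' => hne.2 (h2 h')
  have h5 : y = (x + (1 / 2 : ℝ) • y) - (x - (1 / 2 : ℝ) • y) := by module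
  have h6 := norm_sub_le (x + (1 / 2 : ℝ) • y) (x - (1 / 2 : ℝ) • y)
  rw [← h5] at h6
  linarith

/-- The bound on the positions in the support of `Wψ` confines `ψ` to a ball. Each correlation then
has bounded support, and the bound on the momenta makes its Fourier transform vanish on an open
set, so that all correlations are zero. -/
theorem ae_eq_zero_of_hasCompactSupportAE_wigner (hn : 1 ≤ n) {hbar : ℝ} (hh : 0 < hbar)
    {ψ : Config n → ℂ} (hψm : StronglyMeasurable ψ) (hψ : MemLp ψ 2)
    (hc : HasCompactSupportAE (wigner hbar ψ)) : ψ =ᵐ[volume] 0 := by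
  obtain ⟨R, hR, hW⟩ := hc.exists_radius
  have hpos : 0 < 2 * Real.pi * hbar := by positivity
  rw [Measure.volume_eq_prod] at hW
  have hF : ∀ᵐ x : Config n, ∀ᵐ w : Config n,
      R < ‖(x, (2 * Real.pi * hbar) • w)‖ → 𝓕 (wignerCorrelation ψ ψ x) w = 0 := by
    filter_upwards [Measure.ae_ae_of_ae_prod hW] with x hx
    filter_upwards [(Measure.quasiMeasurePreserving_smul volume hpos.ne').ae hx] with w hw hlt
    have := (wignerMoyal_eq_zero_iff hh.ne' ψ ψ _).1 (hw hlt)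
    rwa [inv_smul_smul₀ hpos.ne'] at this
  have hint : ∀ x, Integrable (wignerCorrelation ψ ψ x) := integrable_wignerCorrelation hψ hψ
  have hsupp : ∀ᵐ x, R < ‖x‖ → ψ x = 0 := by
    refine ae_eq_zero_of_forall_halfSpace hR fun u => ?_
    have hcv : Convex ℝ {x : Config n | R * ‖u‖ < ⟪u, x⟫} :=
      convex_halfSpace_gt (innerₗ (Config n) u).isLinear _
    have ho : IsOpen {x : Config n | R * ‖u‖ < ⟪u, x⟫} := isOpen_lt (by fun_prop) (by fun_prop)
    refine ae_eq_zero_of_wignerCorrelation_ae_eq_zero hψm ho.measurableSet hcv ?_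
    filter_upwards [hF] with x hx hux
    have hRx : R < ‖x‖ := by
      have h1 : R * ‖u‖ < ‖u‖ * ‖x‖ := lt_of_lt_of_le hux (real_inner_le_norm u x)
      rw [mul_comm] at h1
      exact lt_of_mul_lt_mul_left h1 (norm_nonneg u)
    refine ae_eq_zero_of_fourier_ae_eq_zero (hint x) ?_
    filter_upwards [hx] with w hw
    exact hw (hRx.trans_le (le_max_left _ _))
  have hall : ∀ᵐ x : Config n, x ∈ Set.univ → wignerCorrelation ψ ψ x =ᵐ[volume] 0 := by
    filter_upwards [hF] with x hx _
    have ho : IsOpen {w : Config n | R < ‖(2 * Real.pi * hbar) • w‖} :=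
      isOpen_lt (by fun_prop) (by fun_prop)
    refine ae_eq_zero_of_fourier_eqOn_zero (hint x)
      (ae_lt_norm_wignerCorrelation_eq_zero hsupp x) ho ?_ ?_
    · have : Nonempty (Fin n) := ⟨⟨0, hn⟩⟩
      obtain ⟨w, hw⟩ := NormedSpace.exists_lt_norm ℝ (Config n) R
      exact ⟨(2 * Real.pi * hbar)⁻¹ • w, by rwa [Set.mem_ofPred_eq, smul_inv_smul₀ hpos.ne']⟩
    · refine Measure.eqOn_open_of_ae_eq (μ := volume) ?_ ho
        (continuous_fourier_of_integrable (hint x)).continuousOn continuousOn_const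
      rw [Filter.EventuallyEq, ae_restrict_iff' ho.measurableSet]
      filter_upwards [hx] with w hw hlt
      exact hw (lt_of_lt_of_le hlt (le_max_right _ _))
  have := ae_eq_zero_of_wignerCorrelation_ae_eq_zero hψm .univ convex_univ hall
  filter_upwards [this] with x hx using hx trivial

end PureState

/-! ### Mixed states -/

section MixedState

variable {n : ℕ} {hbar : ℝ} {T : L2Space n →L[ℂ] L2Space n} {ρ : PhaseSpace n → ℂ}

/-- If `W(ψ, ψ)` vanishes on a ball carrying `ρ`, then `⟨ψ, T ψ⟩ = 0`, and `T` is positive. -/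
theorem IsWignerDistribution.apply_toLp_eq_zero (hT : T.IsPositive)
    (hρ : IsWignerDistribution hbar T ρ) {R : ℝ} (hR : ∀ᵐ z, R < ‖z‖ → ρ z = 0)
    {ψ : 𝓢(Config n, ℂ)} (hψ : ∀ z : PhaseSpace n, ‖z‖ ≤ R → wignerMoyal hbar ψ ψ z = 0) :
    T (ψ.toLp 2) = 0 := by
  refine hT.apply_eq_zero_of_inner_eq_zero ?_
  rw [(hρ ψ ψ).2, integral_eq_zero_of_ae, mul_zero]
  filter_upwards [hR] with z hz
  rcases le_or_gt ‖z‖ R with h | h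
  · simp [hψ z h]
  · simp [hz h]

theorem integral_conj_mul_eq_zero_of_apply_toLp_eq_zero (hT : T.IsPositive) {ψ : 𝓢(Config n, ℂ)}
    (h : T (ψ.toLp 2) = 0) (g : L2Space n) : ∫ x, conj (ψ x) * T g x = 0 := by
  have h0 : inner ℂ (ψ.toLp 2) (T g) = 0 := by
    rw [← hT.inner_left_eq_inner_right, h, inner_zero_left]
  rw [L2.inner_def] at h0
  rw [← h0]
  refine integral_congr_ae ?_
  filter_upwards [ψ.coeFn_toLp 2 volume] with x hx
  rw [hx, RCLike.inner_apply, mul_comm]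

theorem inner_le_norm_of_norm_prod_le {z : PhaseSpace n} {R : ℝ} (hz : ‖z‖ ≤ R) (u : Config n) :
    ⟪u, z.1⟫ ≤ R * ‖u‖ ∧ ⟪u, z.2⟫ ≤ R * ‖u‖ := by
  constructor
  · refine (real_inner_le_norm _ _).trans ?_
    rw [mul_comm]
    exact mul_le_mul_of_nonneg_right ((norm_fst_le z).trans hz) (norm_nonneg u)
  · refine (real_inner_le_norm _ _).trans ?_
    rw [mul_comm]
    exact mul_le_mul_of_nonneg_right ((norm_snd_le z).trans hz) (norm_nonneg u)

/-- `T` kills the test functions supported in a half-space of positions that does not meet the support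
of `ρ`; being self-adjoint, it has range orthogonal to them. -/
theorem IsWignerDistribution.ae_lt_norm_apply_eq_zero (hh : 0 < hbar) (hT : T.IsPositive)
    (hρ : IsWignerDistribution hbar T ρ) {R : ℝ} (hR0 : 0 ≤ R) (hR : ∀ᵐ z, R < ‖z‖ → ρ z = 0)
    (g : L2Space n) : ∀ᵐ x, R < ‖x‖ → T g x = 0 := by
  refine ae_eq_zero_of_forall_halfSpace hR0 fun u => ?_
  have ho : IsOpen {x : Config n | R * ‖u‖ < ⟪u, x⟫} := isOpen_lt (by fun_prop) (by fun_prop)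
  have hloc : LocallyIntegrable (T g) := (Lp.memLp (T g)).locallyIntegrable one_le_two
  refine ho.ae_eq_zero_of_integral_contDiff_smul_eq_zero (hloc.locallyIntegrableOn _)
    fun χ hχ hχc hχU => ?_
  obtain ⟨ψ, hψ⟩ := exists_schwartzMap_eq_ofReal hχ hχc
  have hψ0 : ∀ y, ⟪u, y⟫ ≤ R * ‖u‖ → ψ y = 0 := fun y hy => by
    rw [hψ, image_eq_zero_of_notMem_tsupport fun h => hy.not_gt (hχU h), Complex.ofReal_zero]
  have hker : T (ψ.toLp 2) = 0 := hρ.apply_toLp_eq_zero hT hR fun z hz => by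
    rw [wignerMoyal_eq_zero_iff hh.ne',
      wignerCorrelation_eq_zero_of_halfSpace hψ0 (inner_le_norm_of_norm_prod_le hz u).1,
      Real.fourier_eq]
    simp
  rw [← integral_conj_mul_eq_zero_of_apply_toLp_eq_zero hT hker g]
  refine integral_congr_ae (.of_forall fun x => ?_)
  simp [hψ]

theorem conj_fourierInv (χ : 𝓢(Config n, ℂ)) (hχ : ∀ x, conj (χ x) = χ x) (x : Config n) :
    conj ((𝓕⁻ χ : 𝓢(Config n, ℂ)) x) = 𝓕 (χ : Config n → ℂ) x := by
  rw [SchwartzMap.fourierInv_coe, Real.fourierInv_eq, Real.fourier_eq, ← integral_conj]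
  refine integral_congr_ae (.of_forall fun ξ => ?_)
  simp only [Circle.smul_def, smul_eq_mul, map_mul, hχ, ← Circle.coe_inv_eq_conj,
    ← AddChar.map_neg_eq_inv]

/-- The momentum counterpart: `T` kills the functions whose Fourier transform is a test function
supported in a half-space of (rescaled) momenta that does not meet the support of `ρ`. -/
theorem IsWignerDistribution.fourier_apply_eq_zero (hh : 0 < hbar) (hT : T.IsPositive)
    (hρ : IsWignerDistribution hbar T ρ) {R : ℝ} (hR : ∀ᵐ z, R < ‖z‖ → ρ z = 0)
    (g : L2Space n) (hg : Integrable (T g)) (u : Config n) :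
    Set.EqOn (𝓕 (T g : Config n → ℂ)) 0 {w | (2 * Real.pi * hbar)⁻¹ * (R * ‖u‖) < ⟪u, w⟫} := by
  have hpos : 0 < 2 * Real.pi * hbar := by positivity
  set c := (2 * Real.pi * hbar)⁻¹ * (R * ‖u‖)
  have ho : IsOpen {x : Config n | c < ⟪u, x⟫} := isOpen_lt (by fun_prop) (by fun_prop)
  have hcont := continuous_fourier_of_integrable hg
  refine Measure.eqOn_open_of_ae_eq (μ := volume) ?_ ho hcont.continuousOn
    continuous_zero.continuousOn
  rw [Filter.EventuallyEq, ae_restrict_iff' ho.measurableSet]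
  refine ho.ae_eq_zero_of_integral_contDiff_smul_eq_zero
    (hcont.locallyIntegrable.locallyIntegrableOn _) fun χ₀ hχ₀ hχc hχU => ?_
  obtain ⟨χ, hχ⟩ := exists_schwartzMap_eq_ofReal hχ₀ hχc
  have hχ0 : ∀ y, ⟪u, y⟫ ≤ c → χ y = 0 := fun y hy => by
    rw [hχ, image_eq_zero_of_notMem_tsupport fun h => hy.not_gt (hχU h), Complex.ofReal_zero]
  have hker : T ((𝓕⁻ χ : 𝓢(Config n, ℂ)).toLp 2) = 0 :=
    hρ.apply_toLp_eq_zero hT hR fun z hz => by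
      rw [wignerMoyal_eq_zero_iff hh.ne']
      refine fourier_wignerCorrelation_eq_zero_of_halfSpace χ hχ0 z.1 ?_
      rw [inner_smul_right]
      exact mul_le_mul_of_nonneg_left (inner_le_norm_of_norm_prod_le hz u).2 (inv_pos.2 hpos).le
  calc ∫ ξ, χ₀ ξ • 𝓕 (T g : Config n → ℂ) ξ = ∫ ξ, χ ξ * 𝓕 (T g : Config n → ℂ) ξ := by simp [hχ]
    _ = ∫ x, 𝓕 (χ : Config n → ℂ) x * T g x :=
        (integral_fourier_mul_eq_of_integrable χ.integrable hg).symm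
    _ = ∫ x, conj ((𝓕⁻ χ : 𝓢(Config n, ℂ)) x) * T g x := by
        simp only [conj_fourierInv χ (fun x => by simp [hχ])]
    _ = 0 := integral_conj_mul_eq_zero_of_apply_toLp_eq_zero hT hker g

/-- Every `T g` vanishes outside a ball, and its Fourier transform vanishes on a half-space. -/
theorem IsWignerDistribution.eq_zero_of_hasCompactSupportAE (hn : 1 ≤ n) (hh : 0 < hbar)
    (hT : T.IsPositive) (hρ : IsWignerDistribution hbar T ρ) (hc : HasCompactSupportAE ρ) :
    T = 0 := by
  obtain ⟨R, hR0, hR⟩ := hc.exists_radius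
  refine ContinuousLinearMap.ext fun g => ?_
  have hsupp := hρ.ae_lt_norm_apply_eq_zero hh hT hR0 hR g
  have hint : Integrable (T g) := by
    have hball : IntegrableOn (T g) (Metric.closedBall 0 R) :=
      ((Lp.memLp (T g)).locallyIntegrable one_le_two).integrableOn_isCompact
        (isCompact_closedBall _ _)
    refine hball.integrable_of_ae_notMem_eq_zero ?_
    filter_upwards [hsupp] with x hx hxR
    exact hx (by simpa using hxR)
  have : Nonempty (Fin n) := ⟨⟨0, hn⟩⟩
  obtain ⟨u, hu⟩ := exists_ne (0 : Config n)
  rw [zero_apply, Lp.eq_zero_iff_ae_eq_zero]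
  have ho : IsOpen {w : Config n | (2 * Real.pi * hbar)⁻¹ * (R * ‖u‖) < ⟪u, w⟫} :=
    isOpen_lt (by fun_prop) (by fun_prop)
  refine ae_eq_zero_of_fourier_eqOn_zero hint hsupp ho ?_
    (hρ.fourier_apply_eq_zero hh hT hR g hint u)
  have huu : 0 < ⟪u, u⟫ := real_inner_self_pos.2 hu
  refine ⟨(((2 * Real.pi * hbar)⁻¹ * (R * ‖u‖) + 1) / ⟪u, u⟫) • u, ?_⟩
  rw [Set.mem_ofPred_eq, inner_smul_right, div_mul_cancel₀ _ huu.ne']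
  exact lt_add_one _

end MixedState

/-! ### Absence of compactly supported Wigner distributions -/

theorem mainTheorem4 (n : ℕ) (hn : 1 ≤ n) (hbar : ℝ) (hhbar : 0 < hbar) :
    (∀ ψ : L2Space n, ψ ≠ 0 → ¬ HasCompactSupportAE (wigner hbar ψ)) ∧
    (∀ T : L2Space n →L[ℂ] L2Space n, IsDensityOperator T →
      ∀ ρ : PhaseSpace n → ℂ, IsWignerDistribution hbar T ρ → ¬ HasCompactSupportAE ρ) := by
  refine ⟨fun ψ hψ hc => hψ ?_, fun T hT ρ hρ hc => ?_⟩
  · rw [Lp.eq_zero_iff_ae_eq_zero]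
    exact ae_eq_zero_of_hasCompactSupportAE_wigner hn hhbar (Lp.stronglyMeasurable ψ)
      (Lp.memLp ψ) hc
  · obtain ⟨ι, b, hb⟩ := hT.trace_eq_one
    rw [hρ.eq_zero_of_hasCompactSupportAE hn hhbar hT.isPositive hc] at hb
    simp only [zero_apply, inner_zero_right] at hb
    exact zero_ne_one (hasSum_zero.unique hb)
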